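/- Let $\Gamma$ be a (finite, connected, simple, undirected) distance-regular graph with diameter $D \geqslant 3$. Suppose that $\Gamma$ is locally a conference graph, i.e., for every vertex $x$ the subgraph of $\Gamma$ induced on the set of neighbours of $x$ is a strongly regular graph with parameters $(4\mu+1, 2\mu, \mu-1, \mu)$ for some integer $\mu > 0$. Then $\Gamma$ is a Taylor graph, i.e., $\Gamma$ has diameter $3$ and its intersection array $\{b_0,b_1,b_2;c_1,c_2,c_3\}$ is $\{k, c, 1; 1, c, k\}$ for some positive integers $k$ and $c$. (Here, for vertices $x,y$ at distance $i$, $b_i$ and $c_i$ denote the numbers of neighbours of $y$ at distance $i+1$ and $i-1$ from $x$, respectively.) -/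

import Mathlib

namespace SimpleGraph

/-- `C_i(x, y)`: the neighbours of `y` at distance `i - 1` from `x` (empty for `i = 0`). -/
def cSet {V : Type*} (G : SimpleGraph V) (i : ℕ) (x y : V) : Set V :=
  {z | G.Adj y z ∧ G.dist x z + 1 = i}

/-- `A_i(x, y)`: the neighbours of `y` at distance `i` from `x`. -/
def aSet {V : Type*} (G : SimpleGraph V) (i : ℕ) (x y : V) : Set V :=
  {z | G.Adj y z ∧ G.dist x z = i}

/-- `B_i(x, y)`: the neighbours of `y` at distance `i + 1` from `x`. -/
def bSet {V : Type*} (G : SimpleGraph V) (i : ℕ) (x y : V) : Set V :=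
  {z | G.Adj y z ∧ G.dist x z = i + 1}

/-- `G` is a (finite, connected) distance-regular graph with intersection numbers
`b i`, `a i`, `c i` for `0 ≤ i ≤ D`, where `D` is the diameter; the values of `b`, `a`, `c`
beyond `D` are irrelevant. -/
structure IsDistanceRegularWith {V : Type*} (G : SimpleGraph V) (b a c : ℕ → ℕ) : Prop where
  finite : Finite V
  connected : G.Connected
  card_cSet : ∀ i ≤ G.diam, ∀ x y : V, G.dist x y = i → (G.cSet i x y).ncard = c i
  card_aSet : ∀ i ≤ G.diam, ∀ x y : V, G.dist x y = i → (G.aSet i x y).ncard = a i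
  card_bSet : ∀ i ≤ G.diam, ∀ x y : V, G.dist x y = i → (G.bSet i x y).ncard = b i

/-- `G` is a distance-regular graph. -/
def IsDistanceRegular {V : Type*} (G : SimpleGraph V) : Prop :=
  ∃ b a c : ℕ → ℕ, G.IsDistanceRegularWith b a c

/-- The local graph of `G` at `x`: the subgraph induced on the neighbours of `x`. -/
abbrev localGraph {V : Type*} (G : SimpleGraph V) (x : V) : SimpleGraph (G.neighborSet x) :=
  G.induce (G.neighborSet x)

/-- A conference graph: a (finite) strongly regular graph with parameters
`(4μ + 1, 2μ, μ - 1, μ)` for some `μ > 0`. -/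
def IsConferenceGraph {W : Type*} (H : SimpleGraph W) : Prop :=
  ∃ (_ : Fintype W) (_ : DecidableEq W) (_ : DecidableRel H.Adj) (μ : ℕ),
    0 < μ ∧ H.IsSRGWith (4 * μ + 1) (2 * μ) (μ - 1) μ

/-- `G` is locally a conference graph: every local graph is a conference graph. -/
def IsLocallyConference {V : Type*} (G : SimpleGraph V) : Prop :=
  ∀ x : V, (G.localGraph x).IsConferenceGraph

/-- A Taylor graph: a distance-regular graph of diameter three with intersection array
`{k, μ, 1; 1, μ, k}` for some `k` and `μ`. -/
def IsTaylorGraph {V : Type*} (G : SimpleGraph V) : Prop :=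
  G.diam = 3 ∧ ∃ b a c : ℕ → ℕ, G.IsDistanceRegularWith b a c ∧
    ∃ k μ : ℕ, b 0 = k ∧ b 1 = μ ∧ b 2 = 1 ∧ c 1 = 1 ∧ c 2 = μ ∧ c 3 = k

end SimpleGraph

/-!
Write `k = 4m + 1` for the valency, so that the local graphs have valency `2m` and
`a₁ = b₁ = 2m`. Besides its valency, a conference graph on `k` vertices has the eigenvalues
`(-1 ± √k) / 2`, the roots of `η² + η = m`.

Let `θ ≠ k` be an eigenvalue of the graph. A positive multiple `P` of the projection onto its
eigenspace is a polynomial in the adjacency matrix `A`, hence a function of the distance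
(`IsDistanceRegularWith.exists_posSemidef`). Restricting the positive semidefinite matrix `P` to the
neighbours of a vertex and testing it against a local eigenvector for `η` gives
`2m + (θ + 1)(1 + η) ≥ 0`. The product of these inequalities for the two values of `η` is
`m (k - θ²) ≥ 0`. So every eigenvalue other than `k` satisfies `θ² ≤ k`
(`IsDistanceRegularWith.eigenvalue_sq_le`), which means that `‖A f‖² ≤ k ‖f‖²` whenever `f` is
orthogonal to the constants.

Applied to the indicator of a closed neighbourhood, projected orthogonally to the constants, this
bounds the number `v` of vertices by `v (2m + c₂ + 2) ≤ 8 (2m + 1)²`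
(`IsDistanceRegularWith.card_mul_le`). On the other hand, as `D ≥ 3`, we have `c₂ ≤ b₁ = 2m` and
`v ≥ 1 + k + k₂ + 1`, where `k₂ c₂ = 2mk`. These inequalities are compatible only if `c₂ = 2m` and
`v = 2k + 2` (`eq_of_card_mul_le`). Then a vertex has a single vertex at distance at least `3`, and
`D = 3`, `b₂ = 1` and `c₃ = k` follow.
-/

open Finset Matrix Polynomial

/-! ### Polynomials in the adjacency matrix -/

namespace SimpleGraph

theorem IsDistanceRegularWith.dist_le_diam {V : Type*} {G : SimpleGraph V} {b a c : ℕ → ℕ}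
    (h : G.IsDistanceRegularWith b a c) (x y : V) : G.dist x y ≤ G.diam := by
  have := h.finite
  have := h.connected.nonempty
  exact SimpleGraph.dist_le_diam (connected_iff_ediam_ne_top.mp h.connected)

/-- The neighbours of `y` are at distance `i - 1`, `i` or `i + 1` from `x`, where `i = dist x y`. For
`i = 0` the truncated subtraction is harmless, because `c 0 = 0`. -/
theorem IsDistanceRegularWith.sum_neighborFinset {V : Type*} [Fintype V] {G : SimpleGraph V}
    [DecidableRel G.Adj] {b a c : ℕ → ℕ}
    (h : G.IsDistanceRegularWith b a c) (φ : ℕ → ℝ) (x y : V) :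
    ∑ z ∈ G.neighborFinset y, φ (G.dist x z) =
      c (G.dist x y) * φ (G.dist x y - 1) + a (G.dist x y) * φ (G.dist x y)
        + b (G.dist x y) * φ (G.dist x y + 1) := by
  have hd := h.dist_le_diam x y
  have hc := h.card_cSet _ hd x y rfl
  have ha := h.card_aSet _ hd x y rfl
  have hb := h.card_bSet _ hd x y rfl
  have hc' : G.cSet (G.dist x y) x y =
      ↑((G.neighborFinset y).filter fun z => G.dist x z + 1 = G.dist x y) := by
    ext z; simp [cSet]
  have ha' : G.aSet (G.dist x y) x y =
      ↑((G.neighborFinset y).filter fun z => G.dist x z = G.dist x y) := by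
    ext z; simp [aSet]
  have hb' : G.bSet (G.dist x y) x y =
      ↑((G.neighborFinset y).filter fun z => G.dist x z = G.dist x y + 1) := by
    ext z; simp [bSet]
  rw [hc', Set.ncard_coe_finset] at hc
  rw [ha', Set.ncard_coe_finset] at ha
  rw [hb', Set.ncard_coe_finset] at hb
  rw [← hc, ← ha, ← hb]
  simp only [← sum_boole, sum_mul, ← sum_add_distrib]
  refine sum_congr rfl fun z hz => ?_
  rw [mem_neighborFinset] at hz
  have h1 : G.dist x z = G.dist x y ∨ G.dist x z = G.dist x y + 1 ∨ G.dist x z + 1 = G.dist x y := by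
    have := Adj.diff_dist_adj (u := x) hz
    omega
  rcases h1 with h1 | h1 | h1
  · simp [h1]
  · simp [h1, show ¬ G.dist x y + 1 + 1 = G.dist x y by omega]
  · simp [← h1, show ¬ G.dist x z = G.dist x z + 1 + 1 by omega]

variable {V : Type*} [Fintype V] [DecidableEq V] {G : SimpleGraph V} [DecidableRel G.Adj]

/-- Every polynomial in the adjacency matrix of a distance-regular graph is a function of the
distance. -/
theorem IsDistanceRegularWith.aeval_adjMatrix_apply {b a c : ℕ → ℕ}
    (h : G.IsDistanceRegularWith b a c) (p : ℝ[X]) :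
    ∃ φ : ℕ → ℝ, ∀ x y, aeval (G.adjMatrix ℝ) p x y = φ (G.dist x y) := by
  induction p using Polynomial.induction_on with
  | C r =>
    refine ⟨fun i => if i = 0 then r else 0, fun x y => ?_⟩
    simp [aeval_C, Matrix.algebraMap_matrix_apply, h.connected.dist_eq_zero_iff]
  | add p q hp hq =>
    obtain ⟨φ, hφ⟩ := hp
    obtain ⟨ψ, hψ⟩ := hq
    exact ⟨fun i => φ i + ψ i, fun x y => by simp [hφ, hψ]⟩
  | monomial n r hn =>
    obtain ⟨φ, hφ⟩ := hn
    refine ⟨fun i => c i * φ (i - 1) + a i * φ i + b i * φ (i + 1), fun x y => ?_⟩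
    rw [pow_succ, ← mul_assoc, map_mul, aeval_X, mul_adjMatrix_apply]
    simp only [hφ]
    exact h.sum_neighborFinset φ x y

/-- To each eigenvalue `θ` of a distance-regular graph belongs a nonzero positive semidefinite matrix
`P` whose entries depend on the distance alone and which satisfies `P A = θ P`. Up to scaling, `φ` is
the cosine sequence of `θ`. -/
theorem IsDistanceRegularWith.exists_posSemidef {b a c : ℕ → ℕ}
    (h : G.IsDistanceRegularWith b a c) {θ : ℝ} {f : V → ℝ} (hf0 : f ≠ 0)
    (hf : G.adjMatrix ℝ *ᵥ f = θ • f) :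
    ∃ φ : ℕ → ℝ, 0 < φ 0 ∧ (Matrix.of fun x y => φ (G.dist x y)).PosSemidef ∧
      ∀ i ≤ G.diam, (∃ x y, G.dist x y = i) →
        c i * φ (i - 1) + a i * φ i + b i * φ (i + 1) = θ * φ i := by
  set A := G.adjMatrix ℝ with hA
  have hroot : (minpoly ℝ A).IsRoot θ := by
    rw [← Matrix.minpoly_toLin']
    refine Module.End.isRoot_of_hasEigenvalue (Module.End.hasEigenvalue_of_hasEigenvector (x := f) ?_)
    rw [Module.End.hasEigenvector_iff, Module.End.mem_eigenspace_iff]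
    exact ⟨by simpa using hf, hf0⟩
  -- With `minpoly A = (X - θ) q`, the matrix `M = q(A)` is a nonzero multiple of the orthogonal
  -- projection onto the `θ`-eigenspace, and `P = Mᴴ M = q(A)²`.
  obtain ⟨q, hq⟩ := dvd_iff_isRoot.mpr hroot
  have hint : IsIntegral ℝ A := Algebra.IsIntegral.isIntegral A
  have hmon : q.Monic := (monic_X_sub_C θ).of_mul_monic_left (hq ▸ minpoly.monic hint)
  have hM0 : aeval A q ≠ 0 :=
    minpoly.aeval_ne_zero_of_dvdNotUnit_minpoly hint hmon
      ⟨hmon.ne_zero, X - C θ, not_isUnit_X_sub_C θ, by rw [hq, mul_comm]⟩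
  set M := aeval A q with hM
  have hAM : M * A = θ • M := by
    have h1 := minpoly.aeval ℝ A
    rw [hq, mul_comm, map_mul, map_sub, aeval_X, aeval_C, mul_sub, sub_eq_zero] at h1
    rw [h1, ← Algebra.commutes, Algebra.smul_def]
  obtain ⟨ψ, hψ⟩ := h.aeval_adjMatrix_apply q
  have hMT : Mᴴ = M := by
    ext x y
    simp [hM, hA, hψ, dist_comm]
  obtain ⟨φ, hφ⟩ := h.aeval_adjMatrix_apply (q * q)
  have hP : (Matrix.of fun x y => φ (G.dist x y)) = Mᴴ * M := by
    ext x y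
    rw [hMT, of_apply, ← hφ, map_mul]
  have hPA : (Mᴴ * M) * A = θ • (Mᴴ * M) := by
    rw [mul_assoc, hAM, Matrix.mul_smul]
  have hPSD : (Mᴴ * M).PosSemidef := posSemidef_conjTranspose_mul_self M
  refine ⟨φ, ?_, hP ▸ hPSD, ?_⟩
  · have hdiag : ∀ x, (Mᴴ * M) x x = φ 0 := fun x => by
      rw [← hP]; simp
    obtain ⟨x⟩ := h.connected.nonempty
    refine lt_of_le_of_ne (hdiag x ▸ hPSD.diag_nonneg) fun h0 => hM0 ?_
    rw [← trace_conjTranspose_mul_self_eq_zero_iff]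
    exact sum_eq_zero fun x _ => (hdiag x).trans h0.symm
  · rintro i - ⟨x, y, rfl⟩
    have h1 := congrFun (congrFun hPA x) y
    rw [mul_adjMatrix_apply] at h1
    simp only [← hP, of_apply, Matrix.smul_apply, smul_eq_mul] at h1
    rw [← h1, h.sum_neighborFinset]


/-! ### Eigenvectors of conference graphs -/

/-- The instances hidden in `IsConferenceGraph` may be replaced by the ambient ones. -/
theorem IsConferenceGraph.exists_isSRGWith {W : Type*} [Fintype W] {H : SimpleGraph W}
    [DecidableRel H.Adj] (h : H.IsConferenceGraph) :
    ∃ m, 0 < m ∧ H.IsSRGWith (4 * m + 1) (2 * m) (m - 1) m := by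
  obtain ⟨_, _, _, m, hm, hsrg⟩ := h
  refine ⟨m, hm, ?_⟩
  convert hsrg

/-- Both roots of `η² + η = m` are eigenvalues of a conference graph, with eigenvectors orthogonal to
the constants. -/
theorem IsSRGWith.exists_eigenvector_of_conference {m : ℕ} (hm : 0 < m)
    (h : G.IsSRGWith (4 * m + 1) (2 * m) (m - 1) m) {η : ℝ} (hη : η ^ 2 + η = m) :
    ∃ u : V → ℝ, u ≠ 0 ∧ ∑ x, u x = 0 ∧ G.adjMatrix ℝ *ᵥ u = η • u := by
  have hcard : 1 < Fintype.card V := by rw [h.card]; omega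
  obtain ⟨y, z, hyz⟩ := Fintype.exists_pair_of_one_lt_card hcard
  have hm' : (0 : ℝ) < m := by exact_mod_cast hm
  set N := G.adjMatrix ℝ with hN
  set w : V → ℝ := Pi.single y 1 - Pi.single z 1 with hw
  have hsum : ∑ x, w x = 0 := by simp [hw]
  have hone : N *ᵥ (fun _ => (1 : ℝ)) = fun _ => (2 * m : ℝ) := by
    ext x
    have h1 := adjMatrix_mulVec_const_apply_of_regular (a := (1 : ℝ)) (v := x) h.regular
    rw [mul_one] at h1
    exact_mod_cast h1
  have hNsum : ∀ v : V → ℝ, ∑ x, v x = 0 → ∑ x, (N *ᵥ v) x = 0 := by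
    intro v hv
    have h1 : (fun _ => (1 : ℝ)) ⬝ᵥ (N *ᵥ v) = (N *ᵥ (fun _ => (1 : ℝ))) ⬝ᵥ v := by
      rw [dotProduct_mulVec, ← mulVec_transpose, hN, transpose_adjMatrix]
    rw [hone] at h1
    simpa [dotProduct, ← mul_sum, hv] using h1
  have hN2 : N * N = (m : ℝ) • (1 : Matrix V V ℝ) - N + (m : ℝ) • Matrix.of fun _ _ => (1 : ℝ) := by
    have h1 := h.matrix_eq (α := ℝ)
    have h2 := one_add_adjMatrix_add_compl_adjMatrix_eq_of_one (α := ℝ) G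
    have h3 : Matrix.compl N = Gᶜ.adjMatrix ℝ := compl_adjMatrix_eq_adjMatrix_compl _ _
    rw [← hN, h3] at h2
    have hm1 : ((m - 1 : ℕ) : ℝ) = m - 1 := by rw [Nat.cast_pred hm]
    simp only [pow_two, ← hN, ← Nat.cast_smul_eq_nsmul ℝ] at h1
    rw [h1]
    ext i j
    have h4 := congrFun (congrFun h2 i) j
    simp only [Matrix.add_apply, Matrix.smul_apply, smul_eq_mul, Matrix.sub_apply,
      of_apply, Pi.one_apply, hm1] at h4 ⊢
    push_cast
    linear_combination (m : ℝ) * h4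
  have hJ : (Matrix.of fun _ _ => (1 : ℝ) : Matrix V V ℝ) *ᵥ w = 0 := by
    ext x
    simpa [mulVec, dotProduct] using hsum
  have hNN : N *ᵥ (N *ᵥ w) = (m : ℝ) • w - N *ᵥ w := by
    rw [mulVec_mulVec, hN2, add_mulVec, sub_mulVec, smul_mulVec, smul_mulVec, hJ]
    simp
  -- On vectors of sum zero, `N² + N = m`; as `-1 - η` is the other root, `(N + 1 + η) w` is an
  -- eigenvector for `η`. Its value at `y` is `η` or `1 + η`, neither of which vanishes.
  refine ⟨N *ᵥ w + (1 + η) • w, fun h0 => ?_, ?_, ?_⟩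
  · have h1 := congrFun h0 y
    have h2 : (N *ᵥ w) y = - N y z := by
      simp [hw, hN]
    have h3 : N y z = 0 ∨ N y z = 1 := by
      rw [hN, adjMatrix_apply]; split_ifs <;> simp
    have h4 : w y = 1 := by simp [hw, hyz]
    simp only [Pi.add_apply, Pi.smul_apply, smul_eq_mul, Pi.zero_apply, h2, h4] at h1
    rcases h3 with h3 | h3 <;> rw [h3] at h1 <;> nlinarith
  · simp only [Pi.add_apply, Pi.smul_apply, smul_eq_mul, sum_add_distrib, ← mul_sum, hsum,
      hNsum w hsum]
    simp
  · rw [mulVec_add, mulVec_smul, hNN]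
    ext x
    simp only [Pi.add_apply, Pi.smul_apply, smul_eq_mul, Pi.sub_apply]
    linear_combination (- w x) * hη
end SimpleGraph

/-! ### The eigenvalue bound -/

/-- If every eigenvector of `A` not orthogonal to `h` has an eigenvalue with square at most `κ`, then
`‖A h‖² ≤ κ ‖h‖²`. -/
theorem Matrix.IsHermitian.dotProduct_mulVec_self_le {n : Type*} [Fintype n] [DecidableEq n]
    {A : Matrix n n ℝ} (hA : A.IsHermitian) {h : n → ℝ} {κ : ℝ}
    (H : ∀ θ f, f ≠ 0 → A *ᵥ f = θ • f → f ⬝ᵥ h = 0 ∨ θ ^ 2 ≤ κ) :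
    (A *ᵥ h) ⬝ᵥ (A *ᵥ h) ≤ κ * (h ⬝ᵥ h) := by
  have hsq : ∀ g : n → ℝ, g ⬝ᵥ g = ∑ i, ((hA.eigenvectorBasis i).ofLp ⬝ᵥ g) ^ 2 := by
    intro g
    have h1 := hA.eigenvectorBasis.sum_sq_norm_inner_right (WithLp.toLp 2 g)
    rw [EuclideanSpace.real_norm_sq_eq] at h1
    simp only [EuclideanSpace.inner_eq_star_dotProduct, star_trivial, Real.norm_eq_abs,
      sq_abs] at h1
    rw [dotProduct]
    simp only [← pow_two]
    rw [← h1]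
    simp only [dotProduct_comm]
  rw [hsq, hsq, mul_sum]
  refine sum_le_sum fun i _ => ?_
  have h1 : (hA.eigenvectorBasis i).ofLp ⬝ᵥ (A *ᵥ h) =
      hA.eigenvalues i * ((hA.eigenvectorBasis i).ofLp ⬝ᵥ h) := by
    rw [dotProduct_mulVec, ← mulVec_transpose, ← conjTranspose_eq_transpose_of_trivial, hA.eq,
      hA.mulVec_eigenvectorBasis, smul_dotProduct, smul_eq_mul]
  have h2 : (hA.eigenvectorBasis i).ofLp ≠ 0 := by
    intro h0
    exact hA.eigenvectorBasis.orthonormal.ne_zero i (by ext j; simp [h0])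
  rw [h1, mul_pow]
  rcases H _ _ h2 (hA.mulVec_eigenvectorBasis i) with h3 | h3
  · simp [h3]
  · gcongr

namespace SimpleGraph

variable {V : Type*} [Fintype V] [DecidableEq V] {G : SimpleGraph V} [DecidableRel G.Adj]

/-- Testing the restriction of a positive semidefinite function of the distance to the neighbourhood
of `x` against an eigenvector `u` of the local graph: two distinct non-adjacent neighbours of `x` are
at distance `2`, so the restriction is a combination of the identity, the local adjacency matrix and
the all-ones matrix. -/
theorem dotProduct_localGraph_eigenvector (φ : ℕ → ℝ)
    (hpsd : (Matrix.of fun x y => φ (G.dist x y)).PosSemidef) (x : V) {η : ℝ}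
    {u : G.neighborSet x → ℝ} (hu0 : u ≠ 0) (hsum : ∑ y, u y = 0)
    (hu : (G.localGraph x).adjMatrix ℝ *ᵥ u = η • u) :
    0 ≤ φ 0 - φ 2 + (φ 1 - φ 2) * η := by
  set N := (G.localGraph x).adjMatrix ℝ with hN
  have hsub := hpsd.submatrix (Subtype.val : G.neighborSet x → V)
  have heq : (Matrix.of fun x y => φ (G.dist x y)).submatrix
      (Subtype.val : G.neighborSet x → V) Subtype.val =
      (φ 0 - φ 2) • (1 : Matrix (G.neighborSet x) (G.neighborSet x) ℝ) + (φ 1 - φ 2) • N +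
        φ 2 • Matrix.of fun _ _ => (1 : ℝ) := by
    ext y z
    simp only [submatrix_apply, of_apply, Matrix.add_apply, Matrix.smul_apply, smul_eq_mul, hN,
      adjMatrix_apply, Matrix.one_apply, comap_adj, Function.Embedding.subtype_apply]
    by_cases hyz : y = z
    · subst hyz; simp
    · by_cases hadj : G.Adj y z
      · simp [hyz, hadj, dist_eq_one_iff_adj.mpr hadj]
      · have h2 : G.dist y.1 z.1 = 2 := by
          have hyx : G.Adj y.1 x := (G.mem_neighborSet x y.1 |>.mp y.2).symm
          have hxz : G.Adj x z.1 := z.2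
          have hle := dist_le (Walk.cons hyx (Walk.cons hxz Walk.nil))
          have hne1 : G.dist y.1 z.1 ≠ 1 := fun h => hadj (dist_eq_one_iff_adj.mp h)
          have hne0 : G.dist y.1 z.1 ≠ 0 := fun h => hyz <| Subtype.ext <|
            (hyx.reachable.trans hxz.reachable).dist_eq_zero_iff.mp h
          simp only [Walk.length_cons, Walk.length_nil] at hle
          omega
        simp [hyz, hadj, h2]
  have hJ : (Matrix.of fun _ _ => (1 : ℝ) : Matrix (G.neighborSet x) (G.neighborSet x) ℝ) *ᵥ u
      = 0 := by
    ext y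
    simpa [mulVec, dotProduct] using hsum
  have hnn := hsub.dotProduct_mulVec_nonneg u
  rw [heq, add_mulVec, add_mulVec, smul_mulVec, smul_mulVec, smul_mulVec, hJ, hu, star_trivial]
    at hnn
  have hpos : 0 < u ⬝ᵥ u := by
    have := dotProduct_star_self_pos_iff.mpr hu0
    simpa using this
  simp only [one_mulVec, smul_zero, add_zero, dotProduct_add, dotProduct_smul, smul_eq_mul] at hnn
  refine nonneg_of_mul_nonneg_left (b := u ⬝ᵥ u) ?_ hpos
  linarith

/-- Terwilliger's bound in the case of conference local graphs: every eigenvalue other than the valency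
`4m + 1` has square at most the valency. -/
theorem IsDistanceRegularWith.eigenvalue_sq_le {b a c : ℕ → ℕ}
    (h : G.IsDistanceRegularWith b a c) {m : ℕ} (hm : 0 < m) (hb0 : b 0 = 4 * m + 1)
    (ha0 : a 0 = 0) (hc0 : c 0 = 0) (hc1 : c 1 = 1) (ha1 : a 1 = 2 * m) (hb1 : b 1 = 2 * m)
    {x y : V} (hxy : G.Adj x y)
    (hloc : (G.localGraph x).IsSRGWith (4 * m + 1) (2 * m) (m - 1) m)
    {θ : ℝ} {f : V → ℝ} (hf0 : f ≠ 0) (hf : G.adjMatrix ℝ *ᵥ f = θ • f) :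
    θ = 4 * m + 1 ∨ θ ^ 2 ≤ 4 * m + 1 := by
  obtain ⟨φ, hφ0, hpsd, hrec⟩ := h.exists_posSemidef hf0 hf
  have hd : G.dist x y = 1 := dist_eq_one_iff_adj.mpr hxy
  have hrec0 := hrec 0 (Nat.zero_le _) ⟨x, x, dist_self⟩
  have hrec1 := hrec 1 (hd ▸ h.dist_le_diam x y) ⟨x, y, hd⟩
  simp only [ha0, hc0, hb0, hc1, ha1, hb1, Nat.sub_self, zero_add, Nat.reduceAdd] at hrec0 hrec1
  push_cast at hrec0 hrec1
  have hm' : (0 : ℝ) < m := by exact_mod_cast hm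
  have hφ1 : φ 1 ≤ φ 0 := by
    have h1 := hpsd.dotProduct_mulVec_nonneg (Pi.single x 1 - Pi.single y 1)
    simp only [star_trivial, mulVec_sub, sub_dotProduct, dotProduct_sub, mulVec_single_one,
      single_one_dotProduct, col_apply, of_apply, dist_self, hd, dist_comm (u := y) (v := x)] at h1
    linarith
  -- The local inequality at `η`, with `φ 1` and `φ 2` eliminated by the recurrence.
  have key : ∀ η : ℝ, η ^ 2 + η = m →
      0 ≤ φ 0 * (4 * m + 1 - θ) * (2 * m + (θ + 1) * (1 + η)) := by
    intro η hη
    obtain ⟨u, hu0, hsum, hu⟩ := hloc.exists_eigenvector_of_conference hm hη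
    have h1 := dotProduct_localGraph_eigenvector φ hpsd x hu0 hsum hu
    have h2 : φ 0 * (4 * m + 1 - θ) * (2 * m + (θ + 1) * (1 + η)) =
        (2 * m * (4 * m + 1)) * (φ 0 - φ 2 + (φ 1 - φ 2) * η) := by
      linear_combination ((1 + η) * (θ - 2 * m) - 2 * m * η) * hrec0 +
        (4 * m + 1) * (1 + η) * hrec1
    rw [h2]
    positivity
  by_cases hθ : θ = 4 * m + 1
  · exact Or.inl hθ
  right
  have hlt : 0 < φ 0 * (4 * m + 1 - θ) := by
    refine mul_pos hφ0 (sub_pos.mpr (lt_of_le_of_ne ?_ hθ))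
    by_contra hcon
    push Not at hcon
    nlinarith
  set s := √(4 * m + 1 : ℝ) with hs
  have hs2 : s ^ 2 = 4 * m + 1 := Real.sq_sqrt (by positivity)
  have k1 := nonneg_of_mul_nonneg_right (key ((-1 + s) / 2) (by linarith)) hlt
  have k2 := nonneg_of_mul_nonneg_right (key ((-1 - s) / 2) (by linarith)) hlt
  -- The two local eigenvalues `(-1 ± s) / 2` give factors whose product is `m (4m + 1 - θ²)`.
  have k3 := mul_nonneg k1 k2
  have k4 : (m : ℝ) * (4 * m + 1 - θ ^ 2) =
      (2 * m + (θ + 1) * (1 + (-1 + s) / 2)) * (2 * m + (θ + 1) * (1 + (-1 - s) / 2)) := by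
    linear_combination ((θ + 1) ^ 2 / 4) * hs2
  rw [← k4] at k3
  have := nonneg_of_mul_nonneg_right k3 hm'
  linarith

/-- In a connected regular graph the eigenvectors for the valency are constant. -/
theorem Connected.eq_of_adjMatrix_mulVec {d : ℕ} (hconn : G.Connected)
    (hreg : G.IsRegularOfDegree d) {f : V → ℝ} (hf : G.adjMatrix ℝ *ᵥ f = (d : ℝ) • f)
    (x y : V) : f x = f y := by
  have h0 : G.lapMatrix ℝ *ᵥ f = 0 := by
    ext v
    have := congrFun hf v
    rw [adjMatrix_mulVec_apply] at this
    rw [lapMatrix_mulVec_apply, this, hreg v]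
    simp
  exact (lapMatrix_mulVec_eq_zero_iff_forall_reachable G).mp h0 x y (hconn x y)
end SimpleGraph

/-! ### Distances -/

namespace SimpleGraph

theorem Connected.exists_adj_dist_eq {V : Type*} {G : SimpleGraph V} (hconn : G.Connected)
    {x y : V} {n : ℕ} (h : G.dist x y = n + 1) : ∃ z, G.Adj z y ∧ G.dist x z = n := by
  obtain ⟨p, hp⟩ := hconn.exists_walk_length_eq_dist y x
  rw [dist_comm, h] at hp
  cases p with
  | nil => simp at hp
  | @cons _ z _ hadj q =>
    rw [Walk.length_cons, add_left_inj] at hp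
    have h1 := dist_le q
    have h2 := hconn.dist_triangle (u := x) (v := z) (w := y)
    rw [dist_eq_one_iff_adj.mpr hadj.symm] at h2
    rw [dist_comm] at h1
    exact ⟨z, hadj.symm, by omega⟩

theorem Connected.exists_dist_eq {V : Type*} {G : SimpleGraph V} (hconn : G.Connected)
    {x y : V} {n : ℕ} (h : n ≤ G.dist x y) : ∃ z, G.dist x z = n := by
  induction h using Nat.decreasingInduction with
  | self => exact ⟨y, rfl⟩
  | of_succ k _ ih =>
    obtain ⟨z, hz⟩ := ih
    obtain ⟨w, -, hw⟩ := hconn.exists_adj_dist_eq hz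
    exact ⟨w, hw⟩

/-! ### Intersection numbers -/

namespace IsDistanceRegularWith

/-- For a geodesic `x, y, z, w`, every common neighbour of `y` and `w` is a neighbour of `y` at distance
`2` from `x`. -/
theorem c_two_le_b_one {V : Type*} {G : SimpleGraph V} {b a c : ℕ → ℕ}
    (h : G.IsDistanceRegularWith b a c) (hD : 3 ≤ G.diam) {x w : V} (hxw : G.dist x w = 3) :
    c 2 ≤ b 1 := by
  have := h.finite
  obtain ⟨z, hzw, hxz⟩ := h.connected.exists_adj_dist_eq hxw
  obtain ⟨y, hyz, hxy⟩ := h.connected.exists_adj_dist_eq hxz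
  have hwy : G.dist w y = 2 := by
    have h1 := h.connected.dist_triangle (u := x) (v := y) (w := w)
    have h2 := h.connected.dist_triangle (u := y) (v := z) (w := w)
    rw [dist_eq_one_iff_adj.mpr hyz, dist_eq_one_iff_adj.mpr hzw] at h2
    rw [dist_comm]
    omega
  rw [← h.card_cSet 2 (by omega) w y hwy, ← h.card_bSet 1 (by omega) x y hxy]
  refine Set.ncard_le_ncard ?_ (Set.toFinite _)
  rintro p ⟨hyp, hwp⟩
  have h1 := h.connected.dist_triangle (u := x) (v := y) (w := p)
  have h2 := h.connected.dist_triangle (u := x) (v := p) (w := w)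
  rw [dist_eq_one_iff_adj.mpr hyp] at h1
  rw [dist_comm (u := p)] at h2
  exact ⟨hyp, by omega⟩

theorem c_two_pos {V : Type*} {G : SimpleGraph V} {b a c : ℕ → ℕ}
    (h : G.IsDistanceRegularWith b a c) {x z : V} (hxz : G.dist x z = 2) :
    0 < c 2 := by
  have := h.finite
  obtain ⟨y, hyz, hxy⟩ := h.connected.exists_adj_dist_eq hxz
  rw [← h.card_cSet 2 (hxz ▸ h.dist_le_diam x z) x z hxz, Set.ncard_pos]
  exact ⟨y, hyz.symm, by omega⟩

theorem degree_eq {V : Type*} [Fintype V] {G : SimpleGraph V} [DecidableRel G.Adj] {b a c : ℕ → ℕ}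
    (h : G.IsDistanceRegularWith b a c) (x : V) : G.degree x = b 0 := by
  rw [← h.card_bSet 0 (Nat.zero_le _) x x dist_self, ← card_neighborFinset_eq_degree,
    ← Set.ncard_coe_finset]
  congr 1
  ext z
  simp [bSet]

theorem c_zero {V : Type*} {G : SimpleGraph V} {b a c : ℕ → ℕ}
    (h : G.IsDistanceRegularWith b a c) : c 0 = 0 := by
  have := h.finite
  obtain ⟨x⟩ := h.connected.nonempty
  rw [← h.card_cSet 0 (Nat.zero_le _) x x dist_self, Set.ncard_eq_zero]
  ext z
  simp [cSet]

theorem a_zero {V : Type*} {G : SimpleGraph V} {b a c : ℕ → ℕ}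
    (h : G.IsDistanceRegularWith b a c) : a 0 = 0 := by
  have := h.finite
  obtain ⟨x⟩ := h.connected.nonempty
  rw [← h.card_aSet 0 (Nat.zero_le _) x x dist_self, Set.ncard_eq_zero]
  ext z
  simp only [aSet, Set.mem_ofPred_eq, Set.mem_empty_iff_false, iff_false, not_and]
  intro hz
  simp [dist_eq_one_iff_adj.mpr hz]

theorem c_one {V : Type*} {G : SimpleGraph V} {b a c : ℕ → ℕ}
    (h : G.IsDistanceRegularWith b a c) {x y : V} (hxy : G.Adj x y) : c 1 = 1 := by
  have hd := dist_eq_one_iff_adj.mpr hxy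
  rw [← h.card_cSet 1 (hd ▸ h.dist_le_diam x y) x y hd, Set.ncard_eq_one]
  refine ⟨x, ?_⟩
  ext z
  simp only [cSet, Set.mem_ofPred_eq, add_eq_right, h.connected.dist_eq_zero_iff,
    Set.mem_singleton_iff]
  exact ⟨fun hz => hz.2.symm, fun hz => ⟨hz ▸ hxy.symm, hz.symm⟩⟩

theorem add_add_eq {V : Type*} [Fintype V] {G : SimpleGraph V} [DecidableRel G.Adj] {b a c : ℕ → ℕ}
    (h : G.IsDistanceRegularWith b a c) (x y : V) :
    c (G.dist x y) + a (G.dist x y) + b (G.dist x y) = b 0 := by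
  have h1 := h.sum_neighborFinset (fun _ => 1) x y
  rw [sum_const, card_neighborFinset_eq_degree, h.degree_eq] at h1
  simp only [nsmul_eq_mul, mul_one] at h1
  exact_mod_cast h1.symm

theorem a_one {V : Type*} [Fintype V] {G : SimpleGraph V} [DecidableRel G.Adj] {b a c : ℕ → ℕ}
    (h : G.IsDistanceRegularWith b a c) {x y : V} (hxy : G.Adj x y) :
    a 1 = (G.localGraph x).degree ⟨y, hxy⟩ := by
  have hd := dist_eq_one_iff_adj.mpr hxy
  rw [← h.card_aSet 1 (hd ▸ h.dist_le_diam x y) x y hd, ← card_neighborFinset_eq_degree,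
    ← card_map (Function.Embedding.subtype _), ← Set.ncard_coe_finset]
  congr 1
  ext z
  simp [aSet, and_comm]

/-- Double counting of the edges between the neighbours of `x` and the vertices at distance `2`. -/
theorem card_dist_eq_two_mul {V : Type*} [Fintype V] {G : SimpleGraph V} [DecidableRel G.Adj]
    {b a c : ℕ → ℕ} (h : G.IsDistanceRegularWith b a c) (hD : 2 ≤ G.diam) (x : V) :
    #{z | G.dist x z = 2} * c 2 = b 0 * b 1 := by
  have h1 := sum_card_bipartiteAbove_eq_sum_card_bipartiteBelow
    (s := G.neighborFinset x) (t := ({z | G.dist x z = 2} : Finset V)) G.Adj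
  rw [sum_const_nat (m := b 1), sum_const_nat (m := c 2), card_neighborFinset_eq_degree,
    h.degree_eq] at h1
  · exact h1.symm
  · intro z hz
    rw [mem_filter_univ] at hz
    rw [← h.card_cSet 2 hD x z hz, ← Set.ncard_coe_finset]
    congr 1
    ext y
    simp [bipartiteBelow, cSet, adj_comm, and_comm]
  · intro y hy
    rw [mem_neighborFinset] at hy
    rw [← h.card_bSet 1 (by omega) x y (dist_eq_one_iff_adj.mpr hy), ← Set.ncard_coe_finset]
    congr 1
    ext z
    simp [bipartiteAbove, bSet, and_comm]

/-- All local graphs have the same parameters, because the valency determines them. -/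
theorem exists_conference_params {V : Type*} [Fintype V] {G : SimpleGraph V}
    [DecidableRel G.Adj] {b a c : ℕ → ℕ} (h : G.IsDistanceRegularWith b a c)
    (hloc : G.IsLocallyConference) :
    ∃ m : ℕ, 0 < m ∧ b 0 = 4 * m + 1 ∧ c 1 = 1 ∧ a 1 = 2 * m ∧ b 1 = 2 * m ∧
      (∀ x, ∃ y, G.Adj x y) ∧
      ∀ x, (G.localGraph x).IsSRGWith (4 * m + 1) (2 * m) (m - 1) m := by
  have key : ∀ x, ∃ m : ℕ, 0 < m ∧ b 0 = 4 * m + 1 ∧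
      (G.localGraph x).IsSRGWith (4 * m + 1) (2 * m) (m - 1) m := by
    intro x
    obtain ⟨m, hm, hsrg⟩ := (hloc x).exists_isSRGWith
    refine ⟨m, hm, ?_, hsrg⟩
    rw [← h.degree_eq x, ← card_neighborSet_eq_degree, ← hsrg.card]
  obtain ⟨x⟩ := h.connected.nonempty
  obtain ⟨m, hm, hb0, hsrg⟩ := key x
  have hnb : ∀ x, ∃ y, G.Adj x y := by
    intro x
    rw [← degree_pos_iff_exists_adj, h.degree_eq, hb0]
    omega
  obtain ⟨y, hxy⟩ := hnb x
  have hc1 := h.c_one hxy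
  have ha1 : a 1 = 2 * m := (h.a_one hxy).trans (hsrg.regular _)
  have hsum := h.add_add_eq x y
  rw [dist_eq_one_iff_adj.mpr hxy] at hsum
  refine ⟨m, hm, hb0, hc1, ha1, by omega, hnb, fun z => ?_⟩
  obtain ⟨m', -, hb0', hsrg'⟩ := key z
  obtain rfl : m' = m := by omega
  exact hsrg'

variable {V : Type*} [Fintype V] [DecidableEq V] {G : SimpleGraph V} [DecidableRel G.Adj]
  {b a c : ℕ → ℕ}

theorem sum_dist_le_two (h : G.IsDistanceRegularWith b a c) (x : V) {F : ℕ → ℝ}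
    (hF : ∀ i, 3 ≤ i → F i = 0) :
    ∑ z, F (G.dist x z) = F 0 + b 0 * F 1 + #{z | G.dist x z = 2} * F 2 := by
  have h0 : #{z | G.dist x z = 0} = 1 := by
    rw [card_eq_one]
    refine ⟨x, ?_⟩
    ext z
    simp [h.connected.dist_eq_zero_iff, eq_comm]
  have h1 : #{z | G.dist x z = 1} = b 0 := by
    rw [← h.degree_eq x, ← card_neighborFinset_eq_degree]
    congr 1
    ext z
    simp
  have h2 : ∀ i, F i = (if i = 0 then 1 else 0) * F 0 + (if i = 1 then 1 else 0) * F 1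
      + (if i = 2 then 1 else 0) * F 2 := by
    intro i
    match i with
    | 0 => simp
    | 1 => simp
    | 2 => simp
    | n + 3 => simp [hF (n + 3) (by omega)]
  rw [sum_congr rfl fun z _ => h2 (G.dist x z)]
  simp only [sum_add_distrib, ← sum_mul, sum_boole, h0, h1]
  simp

/-! ### Bounding the number of vertices -/

/-- With `k = 4m + 1` the valency and `v` the number of vertices: the vector `f`, which is the
indicator of the closed neighbourhood of `x` minus its mean `(k + 1) / v`, is orthogonal to the
constants, so that `‖A f‖² ≤ k ‖f‖²`. Both sides can be expressed in the intersection numbers. -/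
theorem card_mul_le (h : G.IsDistanceRegularWith b a c) (hD : 2 ≤ G.diam) {m : ℕ} (hm : 0 < m)
    (hb0 : b 0 = 4 * m + 1) (hc1 : c 1 = 1) (ha1 : a 1 = 2 * m) (hb1 : b 1 = 2 * m)
    {x y : V} (hxy : G.Adj x y)
    (hloc : (G.localGraph x).IsSRGWith (4 * m + 1) (2 * m) (m - 1) m) :
    Fintype.card V * (2 * m + c 2 + 2) ≤ 8 * (2 * m + 1) ^ 2 := by
  have hv : (0 : ℝ) < Fintype.card V := by exact_mod_cast Fintype.card_pos_iff.mpr ⟨x⟩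
  have hm' : (0 : ℝ) < m := by exact_mod_cast hm
  have hk2 : (#{z | G.dist x z = 2} : ℝ) * c 2 = (4 * m + 1) * (2 * m) := by
    have := h.card_dist_eq_two_mul hD x
    rw [hb0, hb1] at this
    exact_mod_cast this
  set t : ℝ := (4 * m + 2) / Fintype.card V with ht
  have htv : t * Fintype.card V = 4 * m + 2 := by rw [ht]; field_simp
  -- `φ` and `ψ` are the indicator of the closed neighbourhood and its image under the adjacency
  -- matrix, as functions of the distance from `x`.
  set φ : ℕ → ℝ := fun i => if i ≤ 1 then 1 else 0 with hφ
  set ψ : ℕ → ℝ := fun i => c i * φ (i - 1) + a i * φ i + b i * φ (i + 1) with hψ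
  have hφ3 : ∀ i, 2 ≤ i → φ i = 0 := fun i hi => by simp [hφ]; omega
  have hψ3 : ∀ i, 3 ≤ i → ψ i = 0 := fun i hi => by
    simp [hψ, hφ3 i (by omega), hφ3 (i - 1) (by omega), hφ3 (i + 1) (by omega)]
  have hψ0 : ψ 0 = 4 * m + 1 := by simp [hψ, hφ, h.c_zero, h.a_zero, hb0]
  have hψ1 : ψ 1 = 2 * m + 1 := by simp [hψ, hφ, hc1, ha1]; ring
  have hψ2 : ψ 2 = c 2 := by simp [hψ, hφ]
  set f : V → ℝ := fun z => φ (G.dist x z) - t with hf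
  have hAf : G.adjMatrix ℝ *ᵥ f = fun z => ψ (G.dist x z) - (4 * m + 1) * t := by
    ext z
    rw [adjMatrix_mulVec_apply]
    simp only [hf, sum_sub_distrib, sum_const, card_neighborFinset_eq_degree, h.degree_eq, hb0,
      h.sum_neighborFinset]
    simp [hψ]
  have hSφ := h.sum_dist_le_two x (F := φ) fun i hi => hφ3 i (by omega)
  have hSφ2 := h.sum_dist_le_two x (F := fun i => φ i ^ 2) fun i hi => by simp [hφ3 i (by omega)]
  have hSψ := h.sum_dist_le_two x (F := ψ) hψ3
  have hSψ2 := h.sum_dist_le_two x (F := fun i => ψ i ^ 2) fun i hi => by simp [hψ3 i hi]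
  simp only [hψ0, hψ1, hψ2] at hSψ hSψ2
  have hφ0 : φ 0 = 1 := by simp [hφ]
  have hφ1 : φ 1 = 1 := by simp [hφ]
  simp only [hφ0, hφ1, hφ3 2 le_rfl] at hSφ hSφ2
  rw [hb0] at hSφ hSφ2 hSψ hSψ2
  push_cast at hSφ hSφ2 hSψ hSψ2
  have hsum : ∑ z, f z = 0 := by
    simp only [hf, sum_sub_distrib, hSφ, sum_const, card_univ, nsmul_eq_mul]
    linarith
  have hmain := (isHermitian_adjMatrix (R := ℝ) G).dotProduct_mulVec_self_le (h := f)
    (κ := 4 * m + 1) fun θ g hg0 hg => by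
      rcases h.eigenvalue_sq_le hm hb0 h.a_zero h.c_zero hc1 ha1 hb1 hxy hloc hg0 hg with h1 | h1
      · left
        have hreg : G.IsRegularOfDegree (4 * m + 1) := fun z => (h.degree_eq z).trans hb0
        have hconst := h.connected.eq_of_adjMatrix_mulVec hreg (f := g)
          (by rw [hg, h1]; push_cast; rfl)
        rw [dotProduct, sum_congr rfl fun z _ => by rw [hconst z x], ← mul_sum, hsum, mul_zero]
      · exact Or.inr h1
  have e1 : f ⬝ᵥ f = (4 * m + 2) - 2 * t * (4 * m + 2) + t * (t * Fintype.card V) := by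
    have : ∀ z, f z * f z = φ (G.dist x z) ^ 2 - 2 * t * φ (G.dist x z) + t ^ 2 := fun z => by
      simp only [hf]; ring
    simp only [dotProduct, this, sum_add_distrib, sum_sub_distrib, ← mul_sum, hSφ, hSφ2,
      sum_const, card_univ, nsmul_eq_mul]
    ring
  have e2 : (G.adjMatrix ℝ *ᵥ f) ⬝ᵥ (G.adjMatrix ℝ *ᵥ f) =
      (4 * m + 1) ^ 2 + (4 * m + 1) * (2 * m + 1) ^ 2 + (4 * m + 1) * (2 * m) * c 2
        - 2 * (4 * m + 1) * t * ((4 * m + 1) * (4 * m + 2))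
        + (4 * m + 1) ^ 2 * t * (t * Fintype.card V) := by
    have : ∀ z, (G.adjMatrix ℝ *ᵥ f) z * (G.adjMatrix ℝ *ᵥ f) z = ψ (G.dist x z) ^ 2
        - 2 * (4 * m + 1) * t * ψ (G.dist x z) + (4 * m + 1) ^ 2 * t ^ 2 := fun z => by
      rw [hAf]; ring
    simp only [dotProduct, this, sum_add_distrib, sum_sub_distrib, ← mul_sum, hSψ, hSψ2,
      sum_const, card_univ, nsmul_eq_mul]
    linear_combination (c 2 - 2 * (4 * m + 1) * t) * hk2
  rw [e1, e2, htv] at hmain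
  have h1 : (2 * m * (4 * m + 1) : ℝ) * (2 * m + c 2 + 2) ≤
      (2 * m * (4 * m + 1)) * (4 * t * (2 * m + 1)) := by
    linear_combination hmain
  have h2 : (2 * m + c 2 + 2 : ℝ) ≤ 4 * t * (2 * m + 1) :=
    le_of_mul_le_mul_left h1 (by positivity)
  have h3 : (Fintype.card V : ℝ) * (2 * m + c 2 + 2) ≤ 8 * (2 * m + 1) ^ 2 := by
    calc (Fintype.card V : ℝ) * (2 * m + c 2 + 2)
        ≤ Fintype.card V * (4 * t * (2 * m + 1)) := by gcongr
      _ = 8 * (2 * m + 1) ^ 2 := by linear_combination 4 * (2 * m + 1) * htv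
  exact_mod_cast h3

end IsDistanceRegularWith

/-- The upper and the lower bound for `v` force `c = 2m`: substituting `c = 2m - d` and the lower bound for
`v`, the two sides differ by `2(2m + 1)d² + 2(2m + 1)d + d²`. -/
theorem eq_of_card_mul_le {v m c k₂ : ℕ} (hm : 0 < m) (hc0 : 0 < c) (hc : c ≤ 2 * m)
    (hk : k₂ * c = (4 * m + 1) * (2 * m)) (hv : 4 * m + 3 + k₂ ≤ v)
    (h : v * (2 * m + c + 2) ≤ 8 * (2 * m + 1) ^ 2) :
    c = 2 * m ∧ v = 4 * m + 3 + k₂ := by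
  have hcm : c = 2 * m := by
    obtain ⟨d, hd⟩ := Nat.exists_eq_add_of_le hc
    rcases Nat.eq_zero_or_pos d with rfl | hd0
    · exact hd.symm
    exfalso
    have h1 : (4 * m + 3 + k₂) * (2 * m + c + 2) ≤ 8 * (2 * m + 1) ^ 2 :=
      (Nat.mul_le_mul_right _ hv).trans h
    have h2 := Nat.mul_le_mul_right c h1
    zify at h2 hk hd hd0 hc0 hm
    have hc' : (c : ℤ) = 2 * m - d := by linarith
    have h3 : ((4 * m + 3 + k₂) * (2 * m + c + 2) * c : ℤ) - 8 * (2 * m + 1) ^ 2 * c =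
        2 * (2 * m + 1) * d ^ 2 + 2 * (2 * m + 1) * d + d ^ 2 := by
      rw [hc'] at hk ⊢
      linear_combination (4 * m - d + 2 : ℤ) * hk
    have : (0 : ℤ) < 2 * (2 * m + 1) * d ^ 2 + 2 * (2 * m + 1) * d + d ^ 2 := by positivity
    linarith
  subst hcm
  refine ⟨rfl, le_antisymm ?_ hv⟩
  have hk' : k₂ = 4 * m + 1 := Nat.eq_of_mul_eq_mul_right (by omega) hk
  have : v ≤ 8 * m + 4 := by
    refine Nat.le_of_mul_le_mul_right (c := 4 * m + 2) ?_ (by omega)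
    nlinarith
  omega

end SimpleGraph

/-! ### Recognizing the Taylor graph -/

open SimpleGraph

theorem proposition3 {V : Type*} [Finite V] (G : SimpleGraph V)
    (hG : G.IsDistanceRegular) (hD : 3 ≤ G.diam) (hloc : G.IsLocallyConference) :
    G.IsTaylorGraph := by
  classical
  have := Fintype.ofFinite V
  obtain ⟨b, a, c, h⟩ := hG
  obtain ⟨m, hm, hb0, hc1, ha1, hb1, hnb, hsrg⟩ := h.exists_conference_params hloc
  have := h.connected.nonempty
  obtain ⟨x, y, hxy⟩ := G.exists_dist_eq_diam
  obtain ⟨w, hw⟩ := h.connected.exists_dist_eq (x := x) (y := y) (n := 3) (by omega)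
  obtain ⟨z, hz⟩ := h.connected.exists_dist_eq (x := x) (y := y) (n := 2) (by omega)
  obtain ⟨x', hx'⟩ := hnb x
  have hbound := h.card_mul_le (by omega) hm hb0 hc1 ha1 hb1 hx' (hsrg x)
  have hk2 := h.card_dist_eq_two_mul (by omega) x
  rw [hb0, hb1] at hk2
  have hcard : #{z | G.dist x z ≤ 2} = 4 * m + 2 + #{z | G.dist x z = 2} := by
    have h1 := h.sum_dist_le_two x (F := fun i => if i ≤ 2 then 1 else 0) fun i hi => by
      simp; omega
    simp only [sum_boole, hb0] at h1
    have h2 : (#{z | G.dist x z ≤ 2} : ℝ) = ((4 * m + 2 + #{z | G.dist x z = 2} : ℕ) : ℝ) := by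
      rw [h1]; push_cast; simp; ring
    exact_mod_cast h2
  have hsplit := card_filter_add_card_filter_not (s := (univ : Finset V)) (fun z => G.dist x z ≤ 2)
  rw [card_univ, hcard] at hsplit
  have hpos : 0 < #{z | ¬ G.dist x z ≤ 2} := card_pos.mpr ⟨y, by simp; omega⟩
  obtain ⟨hc2, hv⟩ := eq_of_card_mul_le hm (h.c_two_pos hz)
    (hb1 ▸ h.c_two_le_b_one hD hw) hk2 (by omega) hbound
  -- The vertex count leaves room for a single vertex at distance at least `3` from `x`, namely `y`.
  have hone : #{z | ¬ G.dist x z ≤ 2} ≤ 1 := by omega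
  have huniq : ∀ z, 3 ≤ G.dist x z → z = y := fun z hz =>
    card_le_one.mp hone z (by simp; omega) y (by simp; omega)
  have hyn : ∀ z, G.Adj y z → G.dist x z + 1 = 3 := by
    intro z hyz
    have h1 := h.connected.dist_triangle (u := x) (v := z) (w := y)
    rw [dist_eq_one_iff_adj.mpr hyz.symm] at h1
    have h2 : ¬ 3 ≤ G.dist x z := fun h3 => hyz.ne (huniq z h3).symm
    omega
  have hxy3 : G.dist x y = 3 := by
    obtain ⟨z, hyz⟩ := hnb y
    have h1 := hyn z hyz
    have h2 := h.connected.dist_triangle (u := x) (v := z) (w := y)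
    rw [dist_eq_one_iff_adj.mpr hyz.symm] at h2
    omega
  have hdiam : G.diam = 3 := hxy ▸ hxy3
  obtain ⟨z, hzy, hxz⟩ := h.connected.exists_adj_dist_eq hxy3
  refine ⟨hdiam, b, a, c, h, b 0, 2 * m, rfl, hb1, ?_, hc1, hc2, ?_⟩
  · rw [← h.card_bSet 2 (by omega) x z hxz, Set.ncard_eq_one]
    refine ⟨y, ?_⟩
    ext w
    simp only [bSet, Set.mem_ofPred_eq, Set.mem_singleton_iff]
    exact ⟨fun hw => huniq w (by omega), fun hw => hw ▸ ⟨hzy, hxy3⟩⟩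
  · rw [← h.card_cSet 3 (by omega) x y hxy3, ← h.degree_eq y, ← card_neighborFinset_eq_degree,
      ← Set.ncard_coe_finset]
    congr 1
    ext w
    simp only [cSet, Set.mem_ofPred_eq, coe_neighborFinset, mem_neighborSet]
    exact ⟨fun hw => hw.1, fun hw => ⟨hw, hyn w hw⟩⟩
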